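/- Let $\mathsf A$ be a Grothendieck abelian category, $\mathsf C(\mathsf A)$ the abelian category of unbounded complexes in $\mathsf A$, and $\mathsf K(\mathsf A)$ the homotopy category of complexes. Let $\mathsf C(\mathsf A_{\mathrm{inj}})\subset\mathsf C(\mathsf A)$ be the class of complexes with injective terms, and let $\mathsf C(\mathsf A)^{\mathrm{co}}_{\mathrm{ac}}\subset\mathsf C(\mathsf A)$ be the class of complexes that are coacyclic in the sense of Becker, i.e. the complexes $X$ with $\mathrm{Hom}_{\mathsf K(\mathsf A)}(X,J)=0$ for all $J\in\mathsf C(\mathsf A_{\mathrm{inj}})$. The coderived category $\mathsf D^{\mathrm{co}}(\mathsf A)$ is the Verdier quotient of $\mathsf K(\mathsf A)$ by the coacyclic complexes. For $S\in\mathsf A$ let $G^+(S)$ be the contractible complex $S\xrightarrow{\ \mathrm{id}\ }S$ concentrated in cohomological degrees $0$ and $1$. For a class $\mathsf S_0$ of objects of $\mathsf A$ let $\mathrm{Fil}(\mathsf S_0)$ be the class of objects $F$ admitting a smooth chain $(F_j)_{j\le\alpha}$ indexed by an ordinal $\alpha$ (so $F_j=\varinjlim_{i<j}F_i$ at limit ordinals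 $j$), with $F_0=0$, $F_\alpha=F$, all the maps $F_i\to F_{i+1}$ monomorphisms, and all the quotients $F_{i+1}/F_i$ isomorphic to objects of $\mathsf S_0$. (1) The pair $(\mathsf C(\mathsf A)^{\mathrm{co}}_{\mathrm{ac}},\ \mathsf C(\mathsf A_{\mathrm{inj}}))$ is a hereditary complete cotorsion pair in $\mathsf C(\mathsf A)$. (2) There exists a set $\mathsf S_0$ of objects of $\mathsf A$ such that $\mathsf A=\mathrm{Fil}(\mathsf S_0)$; and for every such set the cotorsion pair in (1) is generated by the complexes $G^+(S)[i]$ with $S\in\mathsf S_0$ and $i\in\mathbb Z$. That is, $\mathsf C(\mathsf A_{\mathrm{inj}})$ is the class of all complexes $C$ with $\mathrm{Ext}^1_{\mathsf C(\mathsf A)}(G^+(S)[i],C)=0$ for all $S\in\mathsf S_0$, $i\in\mathbb Z$, and $\mathsf C(\mathsf A)^{\mathrm{co}}_{\mathrm{ac}}$ is the class of all complexes $X$ with $\mathrm{Ext}^1_{\mathsf C(\mathsf A)}(X,J)=0$ for all $J\in\mathsf C(\mathsf A_{\mathrm{inj}})$. (3) The triple $(\mathsf C(\mathsf A),\ \mathsf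 C(\mathsf A)^{\mathrm{co}}_{\mathrm{ac}},\ \mathsf C(\mathsf A_{\mathrm{inj}}))$ is a cofibrantly generated hereditary abelian model structure on $\mathsf C(\mathsf A)$ (the coderived model structure): there is a cofibrantly generated model structure on $\mathsf C(\mathsf A)$ in which the cofibrations are the monomorphisms with cofibrant cokernel and the fibrations are the epimorphisms with fibrant kernel, which is hereditary (the classes of cofibrant and of trivially cofibrant objects are closed under kernels of epimorphisms, the classes of fibrant and of trivially fibrant objects under cokernels of monomorphisms), and in which all objects are cofibrant, the weakly trivial objects are the coacyclic complexes, and the fibrant objects are the complexes in $\mathsf C(\mathsf A_{\mathrm{inj}})$. (4) The composition $\mathsf K(\mathsf A_{\mathrm{inj}})\to\mathsf K(\mathsf A)\to\mathsf D^{\mathrm{co}}(\mathsf A)$ of the inclusion and the Verdier quotient functor is a triangulated equivalence. -/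

import Mathlib

open CategoryTheory Limits HomotopicalAlgebra ZeroObject

universe w v u

noncomputable section

namespace CoderivedModel

/-! ### Cotorsion pairs in an abelian category -/

section CotorsionPairs

variable {E : Type u} [Category.{v} E] [Abelian E]

/-- The class of objects `X` such that `Ext¹(Y, X) = 0` for all `Y` in `L`. -/
def rightPerpOne [HasExt.{w} E] (L : ObjectProperty E) : ObjectProperty E :=
  fun X ↦ ∀ ⦃Y : E⦄, L Y → Subsingleton (Abelian.Ext Y X 1)

/-- The class of objects `Y` such that `Ext¹(Y, X) = 0` for all `X` in `R`. -/
def leftPerpOne [HasExt.{w} E] (R : ObjectProperty E) : ObjectProperty E :=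
  fun Y ↦ ∀ ⦃X : E⦄, R X → Subsingleton (Abelian.Ext Y X 1)

/-- `(L, R)` is a cotorsion pair. -/
structure IsCotorsionPair [HasExt.{w} E] (L R : ObjectProperty E) : Prop where
  right_eq : R = rightPerpOne L
  left_eq : L = leftPerpOne R

/-- `(L, R)` is the cotorsion pair generated by the class of objects `S`. -/
structure IsGeneratedBy [HasExt.{w} E] (L R S : ObjectProperty E) : Prop where
  right_eq : R = rightPerpOne S
  left_eq : L = leftPerpOne R

/-- `(L, R)` admits special precover sequences and special preenvelope sequences. -/
structure HasApproximationSequences (L R : ObjectProperty E) : Prop where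
  exists_precover (X : E) : ∃ (R' L' : E) (i : R' ⟶ L') (p : L' ⟶ X) (h : i ≫ p = 0),
    (ShortComplex.mk i p h).ShortExact ∧ R R' ∧ L L'
  exists_preenvelope (X : E) : ∃ (R' L' : E) (i : X ⟶ R') (p : R' ⟶ L') (h : i ≫ p = 0),
    (ShortComplex.mk i p h).ShortExact ∧ R R' ∧ L L'

/-- The class `P` contains the kernels of epimorphisms between its objects. -/
def ClosedUnderKernelsOfEpis (P : ObjectProperty E) : Prop :=
  ∀ ⦃X Y : E⦄ (f : X ⟶ Y), Epi f → P X → P Y → P (kernel f)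

/-- The class `P` contains the cokernels of monomorphisms between its objects. -/
def ClosedUnderCokernelsOfMonos (P : ObjectProperty E) : Prop :=
  ∀ ⦃X Y : E⦄ (f : X ⟶ Y), Mono f → P X → P Y → P (cokernel f)

/-- `(L, R)` is a hereditary complete cotorsion pair. For a complete cotorsion pair the conditions
`kernels`, `cokernels` and `ext_eq_zero` are well known to be equivalent; all of them are
included. -/
structure IsHereditaryCompleteCotorsionPair [HasExt.{w} E] (L R : ObjectProperty E) : Prop where
  isCotorsionPair : IsCotorsionPair L R
  complete : HasApproximationSequences L R
  kernels : ClosedUnderKernelsOfEpis L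
  cokernels : ClosedUnderCokernelsOfMonos R
  ext_eq_zero : ∀ ⦃X Y : E⦄, L X → R Y → ∀ n : ℕ, 1 ≤ n → Subsingleton (Abelian.Ext X Y n)

/-- The monomorphisms whose cokernel belongs to `S` (up to isomorphism). -/
def monosWithCokernelIn (S : ObjectProperty E) : MorphismProperty E :=
  fun _ _ f ↦ Mono f ∧ S.isoClosure (cokernel f)

/-- The class `Fil(S)` of the objects `F` filtered by `S`: the map `0 ⟶ F` is a transfinite
composition (the composition of a smooth chain indexed by a well-ordered set) of monomorphisms
with cokernels in `S`. -/
def Fil (S : ObjectProperty E) : ObjectProperty E :=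
  fun F ↦ MorphismProperty.transfiniteCompositions.{w} (monosWithCokernelIn S) (0 : (0 : E) ⟶ F)

end CotorsionPairs

/-! ### Abelian model structures -/

section ModelStructures

variable {E : Type u} [Category.{v} E] [Abelian E]

/-- The weakly trivial objects of a model structure. -/
def weaklyTrivial [ModelCategory E] : ObjectProperty E :=
  fun X ↦ WeakEquivalence (0 : (0 : E) ⟶ X)

/-- The cofibrant objects of a model structure. -/
def cofibrant [ModelCategory E] : ObjectProperty E :=
  fun X ↦ Cofibration (0 : (0 : E) ⟶ X)

/-- The fibrant objects of a model structure. -/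
def fibrant [ModelCategory E] : ObjectProperty E :=
  fun X ↦ Fibration (0 : X ⟶ (0 : E))

/-- A model structure on an abelian category is abelian if the cofibrations are the monomorphisms
with cofibrant cokernel and the fibrations are the epimorphisms with fibrant kernel. -/
structure IsAbelianModel (M : ModelCategory E) : Prop where
  cofibration_iff {X Y : E} (f : X ⟶ Y) : Cofibration f ↔ Mono f ∧ cofibrant (cokernel f)
  fibration_iff {X Y : E} (f : X ⟶ Y) : Fibration f ↔ Epi f ∧ fibrant (kernel f)

/-- A hereditary abelian model structure. The four closure conditions are well known to be
equivalent for an abelian model structure; all of them are included. -/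
structure IsHereditaryAbelianModel (M : ModelCategory E) : Prop extends IsAbelianModel M where
  kernels_cofibrant : ClosedUnderKernelsOfEpis (cofibrant (E := E))
  kernels_trivially_cofibrant : ClosedUnderKernelsOfEpis (cofibrant (E := E) ⊓ weaklyTrivial)
  cokernels_fibrant : ClosedUnderCokernelsOfMonos (fibrant (E := E))
  cokernels_trivially_fibrant : ClosedUnderCokernelsOfMonos (fibrant (E := E) ⊓ weaklyTrivial)

/-- A model structure is cofibrantly generated if there are sets `I` and `J` of morphisms such
that the trivial fibrations (respectively, the fibrations) are the morphisms with the right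
lifting property with respect to `I` (respectively, to `J`). -/
structure IsCofibrantlyGenerated (M : ModelCategory E) : Prop where
  exists_trivialFibrations_eq : ∃ I : MorphismProperty E,
    MorphismProperty.IsSmall.{w} I ∧ trivialFibrations E = I.rlp
  exists_fibrations_eq : ∃ J : MorphismProperty E,
    MorphismProperty.IsSmall.{w} J ∧ fibrations E = J.rlp

/-- The triple of classes of objects `(L, W, R)` is a cofibrantly generated hereditary abelian
model structure: there is such a model structure whose cofibrant, weakly trivial and fibrant
objects are given by `L`, `W` and `R`. -/
def IsCofGenHereditaryAbelianModelTriple (L W R : ObjectProperty E) : Prop :=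
  ∃ M : ModelCategory E, IsHereditaryAbelianModel M ∧ IsCofibrantlyGenerated.{w} M ∧
    cofibrant = L ∧ weaklyTrivial = W ∧ fibrant = R

end ModelStructures

/-! ### Complexes, coacyclic complexes and the coderived category -/

section Complexes

variable (A : Type u) [Category.{v} A] [Abelian A]

/-- The class `C(A_inj)` of the complexes with injective terms. -/
def injComplexes : ObjectProperty (CochainComplex A ℤ) :=
  fun J ↦ ∀ n : ℤ, Injective (J.X n)

/-- The complexes with injective terms, as objects of the homotopy category `K(A)`. -/
def injComplexesHot : ObjectProperty (HomotopyCategory A (ComplexShape.up ℤ)) :=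
  fun J ↦ injComplexes A J.as

instance : (injComplexesHot A).IsStableUnderShift ℤ where
  isStableUnderShiftBy n := ⟨fun J hJ ↦ by
    obtain ⟨J : CochainComplex A ℤ, rfl⟩ := J.quotient_obj_surjective
    rw [ObjectProperty.prop_shift_iff, HomotopyCategory.shift_quotient_obj]
    exact fun m ↦ hJ (m + n)⟩

/-- The coacyclic complexes in the sense of Becker, in `K(A)`: there are no nonzero morphisms
in `K(A)` to complexes of injective objects. -/
def coacyclicHot : ObjectProperty (HomotopyCategory A (ComplexShape.up ℤ)) :=
  (injComplexesHot A).leftOrthogonal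

instance : (coacyclicHot A).IsTriangulated :=
  inferInstanceAs (injComplexesHot A).leftOrthogonal.IsTriangulated

/-- The coacyclic complexes in the sense of Becker, in `C(A)`. -/
def coacyclic : ObjectProperty (CochainComplex A ℤ) :=
  (coacyclicHot A).inverseImage (HomotopyCategory.quotient A (ComplexShape.up ℤ))

/-- The coderived category in the sense of Becker: the Verdier quotient of `K(A)` by the
coacyclic complexes, i.e. the localization of `K(A)` at the morphisms with coacyclic cone. -/
abbrev CoderivedCategory := (coacyclicHot A).trW.Localization

/-- The composition `K(A_inj) ⥤ K(A) ⥤ Dᶜᵒ(A)` of the inclusion and the Verdier quotient. -/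
abbrev injToCoderived :
    HomotopyCategory (InjectiveObject A) (ComplexShape.up ℤ) ⥤ CoderivedCategory A :=
  (InjectiveObject.ι A).mapHomotopyCategory (ComplexShape.up ℤ) ⋙ (coacyclicHot A).trW.Q

variable {A}

/-- The contractible complex `G⁺(S)`, for an object `S` placed in degree `0`: it is
`S ⟶ S` with the identity differential in degrees `0` and `1`, and zero elsewhere. -/
def GPlus (S : A) : CochainComplex A ℤ :=
  HomologicalComplex.double (𝟙 S) (show (ComplexShape.up ℤ).Rel 0 1 from zero_add 1)

/-- The class of complexes `G⁺(S)[i]`, for `S` in `S₀` and `i : ℤ`. -/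
def shiftedGPlus (S₀ : ObjectProperty A) : ObjectProperty (CochainComplex A ℤ) :=
  fun K ↦ ∃ (S : A) (i : ℤ), S₀ S ∧ K = (GPlus S)⟦i⟧

end Complexes

end CoderivedModel

end

noncomputable section

namespace CoderivedModel

open MorphismProperty Abelian CochainComplex HomComplex

/-! ### Lifting properties, filtrations and small objects in abelian categories. -/

section AbelianCategories

variable {E : Type u} [Category.{v} E] [Abelian E]

/-! Everything rests on two weak factorization systems on complexes: monomorphisms against their
right lifting class, and `degreewiseEpiWithInjectiveKernel` with its left lifting class. Since maps
out of `doubleId n S` are maps from `S` into degree `n`, the second system is generated by a set of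
monomorphisms (`generatingTrivialCofibrations_rlp`), so the small object argument provides its
factorizations.

The link with coacyclicity is obstruction theory: lifting a monomorphism `i` against a degreewise
epimorphism `p` with injective kernel is obstructed by a class in Hom from `cokernel i` to `(kernel
p)⟦1⟧` in the homotopy category (`hasLiftingProperty_of_hom_eq_zero`). Conversely, a map to `J` is
null-homotopic exactly when it lifts to the contractible complex `mappingCocone (𝟙 J)`. With weak
equivalences the maps seen as bijections by Hom in K(A) into complexes of injectives, the trivial
cofibrations and trivial fibrations are then identified in `llp_degreewiseEpiWithInjectiveKernel_eq`
and `rlp_monomorphisms_eq_inf`, which gives the model structure.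

The factorizations of `0 ⟶ X` and `X ⟶ 0` are the approximation sequences, and Ext¹ is computed by
embedding into an injective complex. For generation, the vanishing of Ext¹ from the `G⁺(S)[i]` makes
such an embedding split in each degree (`rightPerpOne_shiftedGPlus`). Finally, complexes of
injectives are right orthogonal to coacyclic ones, so K(A_inj) embeds fully faithfully in the
Verdier quotient, and fibrant replacement gives essential surjectivity. -/

theorem rlp_monomorphisms_eq :
    (monomorphisms E).rlp = epiWithInjectiveKernel := by
  refine le_antisymm (fun X Y p hp ↦ ?_) (fun X Y p hp A B i (_ : Mono i) ↦
    hp.hasLiftingProperty i)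
  -- Lifting `𝟙 Y` against `0 ⟶ Y` splits `p`; the kernel is injective because `kernel p ⟶ 0` is a
  -- base change of `p`.
  have := hp (0 : (0 : E) ⟶ Y) (inferInstanceAs (Mono _))
  have sq : CommSq (0 : (0 : E) ⟶ X) (0 : (0 : E) ⟶ Y) p (𝟙 Y) := ⟨by simp⟩
  have : IsSplitEpi p := ⟨⟨sq.lift, sq.fac_right⟩⟩
  refine ⟨inferInstance, ?_⟩
  rw [injective_iff_rlp_monomorphisms_zero]
  refine MorphismProperty.of_isPullback (f' := kernel.ι p) (f := 0) (g := p) ?_ hp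
  exact ⟨⟨by simp⟩, ⟨PullbackCone.IsLimit.mk _ (fun s ↦ kernel.lift p s.fst
    (by rw [s.condition, comp_zero])) (fun s ↦ by simp)
    (fun s ↦ (isZero_zero E).eq_of_tgt _ _) (fun s m h₁ _ ↦ by
      rw [← cancel_mono (kernel.ι p), h₁, kernel.lift_ι])⟩⟩

/-- A monomorphism has the left lifting property with respect to any epimorphism `p` from an
injective object such that the morphisms from the cokernel lift along `p`. -/
theorem hasLiftingProperty_of_injective {X Y I Q : E} (i : X ⟶ Y) [Mono i] (p : I ⟶ Q)
    [Injective I] (h : ∀ f : cokernel i ⟶ Q, ∃ g : cokernel i ⟶ I, g ≫ p = f) :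
    HasLiftingProperty i p where
  sq_hasLift {a b} sq := by
    obtain ⟨g, hg⟩ := h (cokernel.desc i (b - Injective.factorThru a i ≫ p)
      (by simp [Preadditive.comp_sub, sq.w]))
    exact ⟨⟨{ l := Injective.factorThru a i + cokernel.π i ≫ g
              fac_left := by simp
              fac_right := by simp [hg] }⟩⟩

/-- If a class of objects filters all the objects, and all the morphisms from an object of
this class to `Q` lift to the injective object `I`, then the same holds for all objects. -/
theorem isSplitEpi_of_fil_eq_top {S : ObjectProperty E} (hS : Fil.{w} S = ⊤) {I Q : E}
    (p : I ⟶ Q) [Injective I] (h : ∀ ⦃X : E⦄, S X → ∀ f : X ⟶ Q, ∃ g : X ⟶ I, g ≫ p = f) :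
    IsSplitEpi p := by
  have hp : (monosWithCokernelIn S).rlp p := by
    rintro X Y i ⟨_, Z, hZ, ⟨e⟩⟩
    refine hasLiftingProperty_of_injective i p fun f ↦ ?_
    obtain ⟨g, hg⟩ := h hZ (e.inv ≫ f)
    exact ⟨e.hom ≫ g, by simp [hg]⟩
  -- The filtration makes `0 ⟶ Q` lift against `p`; the lift of `𝟙 Q` is the section.
  have hQ : Fil.{w} S Q := by rw [hS]; trivial
  have := transfiniteCompositions_le_llp_rlp _ _ hQ _ hp
  have sq : CommSq (0 : (0 : E) ⟶ I) (0 : (0 : E) ⟶ Q) p (𝟙 Q) := ⟨by simp⟩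
  exact ⟨⟨sq.lift, sq.fac_right⟩⟩

/-- The quotients of a separator `G` suffice: `0 ⟶ F` is a transfinite composition of pushouts of
subobject inclusions into `G`, and pushouts preserve cokernels. -/
theorem exists_small_fil_eq_top [IsGrothendieckAbelian.{w} E] :
    ∃ S : ObjectProperty E, ObjectProperty.Small.{w} S ∧ Fil.{w} S = ⊤ := by
  let G := separator E
  have hG : IsSeparator G := isSeparator_separator E
  refine ⟨ObjectProperty.ofObj (fun X : Subobject G ↦ cokernel X.arrow), inferInstance, ?_⟩
  ext F
  refine iff_of_true ?_ trivial
  obtain ⟨J, _, _, _, _, ⟨h⟩⟩ :=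
    IsGrothendieckAbelian.generatingMonomorphisms.exists_transfiniteCompositionOfShape.{w} hG
      (0 : (0 : E) ⟶ F)
  refine (transfiniteCompositions_iff _ _).2 ⟨J, _, _, _, _,
    transfiniteCompositionsOfShape_monotone J ?_ _ h.mem⟩
  rintro X Y f ⟨A, B, i, t, b, ⟨Z⟩, sq⟩
  have hZ : Mono Z.arrow := inferInstance
  have := isIso_cokernel_map_of_isPushout sq.flip
  exact ⟨MorphismProperty.of_isPushout (P := monomorphisms E) sq hZ, _,
    ⟨Z⟩, ⟨(asIso (cokernel.map _ _ _ _ sq.flip.w)).symm⟩⟩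

/-! ### Ext groups and lifting along short exact sequences. -/

section Ext

variable [HasExt.{w} E] {S : ShortComplex E} (hS : S.ShortExact) (X : E)

include hS

theorem exists_lift_of_subsingleton_ext [Subsingleton (Ext X S.X₁ 1)] (f : X ⟶ S.X₃) :
    ∃ g : X ⟶ S.X₂, g ≫ S.g = f := by
  obtain ⟨x, hx⟩ := Ext.covariant_sequence_exact₃ X hS (Ext.mk₀ f) (zero_add 1)
    (Subsingleton.elim _ _)
  obtain ⟨g, rfl⟩ := Ext.addEquiv₀.symm.surjective x
  refine ⟨g, Ext.addEquiv₀.symm.injective ?_⟩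
  simpa using hx

theorem subsingleton_ext_one_of_exists_lift [Injective S.X₂]
    (h : ∀ f : X ⟶ S.X₃, ∃ g : X ⟶ S.X₂, g ≫ S.g = f) : Subsingleton (Ext X S.X₁ 1) := by
  refine subsingleton_of_forall_eq 0 fun x ↦ ?_
  obtain ⟨y, rfl⟩ := Ext.covariant_sequence_exact₁ X hS x (Ext.eq_zero_of_injective _)
    (zero_add 1)
  obtain ⟨f, rfl⟩ := Ext.addEquiv₀.symm.surjective y
  obtain ⟨g, rfl⟩ := h f
  simp [← Ext.mk₀_comp_mk₀]

theorem subsingleton_ext_succ [Injective S.X₂] (n : ℕ) [Subsingleton (Ext X S.X₃ n)] :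
    Subsingleton (Ext X S.X₁ (n + 1)) := by
  refine subsingleton_of_forall_eq 0 fun x ↦ ?_
  obtain ⟨y, rfl⟩ := Ext.covariant_sequence_exact₁ X hS x (Ext.eq_zero_of_injective _) rfl
  simp [Subsingleton.elim y 0]

end Ext

/-- In a Grothendieck abelian category, any small family of monomorphisms permits the small
object argument. -/
theorem hasSmallObjectArgument_ofHoms_of_mono [IsGrothendieckAbelian.{w} E] {ι : Type*}
    [Small.{w} ι] {X Y : ι → E} (f : ∀ i, X i ⟶ Y i) [∀ i, Mono (f i)] :
    HasSmallObjectArgument.{w} (ofHoms f) := by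
  -- With `κ` larger than every `Subobject (X i)`, Hom from `X i` commutes with colimits of chains
  -- of monomorphisms of length `κ.ord`; cell attachments are such chains.
  obtain ⟨κ, hκ', hκ⟩ := HasCardinalLT.exists_regular_cardinal_forall.{w}
    (fun i ↦ Subobject (X i))
  have : Fact κ.IsRegular := ⟨hκ'⟩
  have : Nonempty κ.ord.ToType := by simpa using hκ'.ne_zero
  have := WellFoundedLT.toOrderBot κ.ord.ToType
  exact ⟨κ, inferInstance, inferInstance,
    { preservesColimit {A B X Y} i hi g hg := by
        let hg' : (monomorphisms E).TransfiniteCompositionOfShape κ.ord.ToType g :=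
          { toTransfiniteCompositionOfShape := hg.toTransfiniteCompositionOfShape
            map_mem j hj := by
              have := (hg.attachCells j hj).pushouts_coproducts
              simp only [ofHoms_homFamily] at this
              refine (?_ : _ ≤ monomorphisms E) _ this
              simp only [pushouts_le_iff, coproducts_le_iff]
              rintro _ _ _ ⟨i⟩
              exact inferInstanceAs (Mono (f i)) }
        have (j j' : κ.ord.ToType) (φ : j ⟶ j') : Mono (hg'.F.map φ) := hg'.mem_map φ
        obtain ⟨i⟩ := hi
        exact IsGrothendieckAbelian.preservesColimit_coyoneda_obj_of_mono
          (Y := hg'.F) (κ := κ) (hκ i) }⟩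

end AbelianCategories

/-! ### The disc complexes `doubleId n S` and their lifting properties. -/

section Doubles

variable {A : Type u} [Category.{v} A] [Abelian A]

/-- The complex `S ⟶ S` in degrees `n` and `n + 1`. -/
abbrev doubleId (n : ℤ) (S : A) : CochainComplex A ℤ :=
  HomologicalComplex.double (𝟙 S) (show (ComplexShape.up ℤ).Rel n (n + 1) from rfl)

/-- The functor `C ↦ Hom(S, Cⁿ)` is corepresented by `doubleId n S`. -/
abbrev doubleIdCorepresentableBy (n : ℤ) (S : A) :
    (HomologicalComplex.eval A (ComplexShape.up ℤ) n ⋙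
      coyoneda.obj (Opposite.op S)).CorepresentableBy (doubleId n S) :=
  HomologicalComplex.evalCompCoyonedaCorepresentableByDoubleId _ (by lia) S

/-- The functoriality of `doubleId`. -/
def doubleIdMap (n : ℤ) {S T : A} (f : S ⟶ T) : doubleId n S ⟶ doubleId n T :=
  HomologicalComplex.mkHomFromDouble _ (by lia)
    (f ≫ (HomologicalComplex.doubleXIso₀ (𝟙 T) _).inv)
    (f ≫ (HomologicalComplex.doubleXIso₁ (𝟙 T) _ (by lia)).inv)
    (by
      rw [HomologicalComplex.double_d (𝟙 T) (show (ComplexShape.up ℤ).Rel n (n + 1) from rfl)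
        (by lia)]
      simp)
    (fun k _ ↦ by
      rw [HomologicalComplex.double_d_eq_zero₀ _ _ _ _ (by lia), comp_zero])

theorem homEquiv_doubleIdMap_comp (n : ℤ) {S T : A} (f : S ⟶ T) {K : CochainComplex A ℤ}
    (g : doubleId n T ⟶ K) :
    (doubleIdCorepresentableBy n S).homEquiv (doubleIdMap n f ≫ g) =
      f ≫ (doubleIdCorepresentableBy n T).homEquiv g := by
  simp [doubleIdMap, doubleIdCorepresentableBy,
    HomologicalComplex.evalCompCoyonedaCorepresentableByDoubleId]
  rfl

theorem homEquiv_doubleId_comp (n : ℤ) {S : A} {K L : CochainComplex A ℤ}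
    (g : doubleId n S ⟶ K) (p : K ⟶ L) :
    (doubleIdCorepresentableBy n S).homEquiv (g ≫ p) =
      (doubleIdCorepresentableBy n S).homEquiv g ≫ p.f n :=
  (doubleIdCorepresentableBy n S).homEquiv_comp p g

theorem hasLiftingProperty_doubleIdMap_iff (n : ℤ) {S T : A} (f : S ⟶ T)
    {K L : CochainComplex A ℤ} (p : K ⟶ L) :
    HasLiftingProperty (doubleIdMap n f) p ↔ HasLiftingProperty f (p.f n) := by
  let eS (K : CochainComplex A ℤ) : (doubleId n S ⟶ K) ≃ (S ⟶ K.X n) :=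
    (doubleIdCorepresentableBy n S).homEquiv
  let eT (K : CochainComplex A ℤ) : (doubleId n T ⟶ K) ≃ (T ⟶ K.X n) :=
    (doubleIdCorepresentableBy n T).homEquiv
  have hS {K L : CochainComplex A ℤ} (g : doubleId n S ⟶ K) (p : K ⟶ L) :
    eS L (g ≫ p) = eS K g ≫ p.f n := homEquiv_doubleId_comp n g p
  have hT {K L : CochainComplex A ℤ} (g : doubleId n T ⟶ K) (p : K ⟶ L) :
    eT L (g ≫ p) = eT K g ≫ p.f n := homEquiv_doubleId_comp n g p
  have hf {K : CochainComplex A ℤ} (g : doubleId n T ⟶ K) :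
    eS K (doubleIdMap n f ≫ g) = f ≫ eT K g := homEquiv_doubleIdMap_comp n f g
  constructor
  · intro h
    refine ⟨fun {a b} sq ↦ ?_⟩
    have sq' : CommSq ((eS K).symm a) (doubleIdMap n f) p ((eT L).symm b) :=
      ⟨(eS L).injective (by rw [hS, hf, Equiv.apply_symm_apply, Equiv.apply_symm_apply, sq.w])⟩
    exact ⟨⟨{ l := eT K sq'.lift
              fac_left := by rw [← hf, sq'.fac_left, Equiv.apply_symm_apply]
              fac_right := by rw [← hT, sq'.fac_right, Equiv.apply_symm_apply] }⟩⟩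
  · intro h
    refine ⟨fun {a b} sq ↦ ?_⟩
    have sq' : CommSq (eS K a) f (p.f n) (eT L b) := ⟨by rw [← hS, ← hf, sq.w]⟩
    exact ⟨⟨{ l := (eT K).symm sq'.lift
              fac_left := (eS K).injective (by
                rw [hf, Equiv.apply_symm_apply, sq'.fac_left])
              fac_right := (eT L).injective (by
                rw [hT, Equiv.apply_symm_apply, sq'.fac_right]) }⟩⟩

instance mono_doubleIdMap (n : ℤ) {S T : A} (f : S ⟶ T) [Mono f] : Mono (doubleIdMap n f) := by
  refine HomologicalComplex.mono_of_mono_f _ fun k ↦ ?_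
  by_cases h₀ : k = n
  · subst h₀
    rw [doubleIdMap, HomologicalComplex.mkHomFromDouble_f₀]
    infer_instance
  by_cases h₁ : k = n + 1
  · subst h₁
    rw [doubleIdMap, HomologicalComplex.mkHomFromDouble_f₁]
    infer_instance
  · exact (HomologicalComplex.isZero_double_X _ _ k h₀ h₁).mono _

end Doubles

/-! ### Complexes with injective terms and the lifting obstruction. -/

section TermwiseInjective

variable {A : Type u} [Category.{v} A] [Abelian A]

/-- The quotient functor to the homotopy category. -/
local notation "Qh" => HomotopyCategory.quotient _ (ComplexShape.up ℤ)

theorem degreewiseEpiWithInjectiveKernel_iff {X Y : CochainComplex A ℤ} (f : X ⟶ Y) :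
    degreewiseEpiWithInjectiveKernel f ↔ Epi f ∧ injComplexes A (kernel f) := by
  have e (n : ℤ) : (kernel f).X n ≅ kernel (f.f n) :=
    PreservesKernel.iso (HomologicalComplex.eval A (ComplexShape.up ℤ) n) f
  refine ⟨fun h ↦ ⟨h.epi, fun n ↦ Injective.of_iso (e n).symm (h n).2⟩, fun ⟨_, h⟩ n ↦
    ⟨?_, Injective.of_iso (e n) (h n)⟩⟩
  exact inferInstanceAs (Epi ((HomologicalComplex.eval A (ComplexShape.up ℤ) n).map f))

theorem injComplexes_cokernel : ClosedUnderCokernelsOfMonos (injComplexes A) := by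
  intro X Y f _ hX hY n
  have := hX n
  have := hY n
  have : Mono (f.f n) :=
    inferInstanceAs (Mono ((HomologicalComplex.eval A (ComplexShape.up ℤ) n).map f))
  have e : (cokernel f).X n ≅ cokernel (f.f n) :=
    PreservesCokernel.iso (HomologicalComplex.eval A (ComplexShape.up ℤ) n) f
  refine Injective.of_iso e.symm ?_
  let S := ShortComplex.mk (f.f n) (cokernel.π (f.f n)) (by simp)
  let σ : S.Splitting := ShortComplex.Splitting.ofExactOfRetraction S
    (S.exact_of_g_is_cokernel (cokernelIsCokernel _)) (Injective.factorThru (𝟙 _) (f.f n))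
    (by simp [S]) inferInstance
  exact Retract.injective (X := cokernel (f.f n)) (Y := Y.X n) ⟨σ.s, S.g, σ.s_g⟩

theorem injComplexes_of_iso {X Y : CochainComplex A ℤ} (e : X ≅ Y) (hX : injComplexes A X) :
    injComplexes A Y :=
  fun n ↦ Injective.of_iso ((HomologicalComplex.eval A (ComplexShape.up ℤ) n).mapIso e) (hX n)

theorem injComplexes_shift {J : CochainComplex A ℤ} (hJ : injComplexes A J) (k : ℤ) :
    injComplexes A (J⟦k⟧) :=
  fun n ↦ hJ (n + k)

theorem degreewiseEpiWithInjectiveKernel_zero {J : CochainComplex A ℤ}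
    (hJ : injComplexes A J) {Z : CochainComplex A ℤ} (hZ : IsZero Z) (f : J ⟶ Z) :
    degreewiseEpiWithInjectiveKernel f :=
  (degreewiseEpiWithInjectiveKernel_iff_of_isZero f hZ).2 hJ

theorem coacyclic_iff (X : CochainComplex A ℤ) :
    coacyclic A X ↔ ∀ ⦃J : CochainComplex A ℤ⦄, injComplexes A J → ∀ f : X ⟶ J,
      (Qh).map f = 0 := by
  refine ⟨fun h J hJ f ↦ h _ hJ, fun h J f hJ ↦ ?_⟩
  obtain ⟨J, rfl⟩ := HomotopyCategory.quotient_obj_surjective J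
  obtain ⟨f, rfl⟩ := (Qh).map_surjective f
  exact h hJ f

/-- A monomorphism has the left lifting property with respect to a degreewise epimorphism with
injective kernel when there is no nonzero morphism up to homotopy from the cokernel of the
former to the shift of the kernel of the latter. -/
theorem hasLiftingProperty_of_hom_eq_zero {X Y K L : CochainComplex A ℤ} (i : X ⟶ Y) [Mono i]
    (p : K ⟶ L) (hp : degreewiseEpiWithInjectiveKernel p)
    (h : ∀ f : (Qh).obj (cokernel i) ⟶ (Qh).obj ((kernel p)⟦(1 : ℤ)⟧), f = 0) :
    HasLiftingProperty i p where
  sq_hasLift {t b} sq := by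
    have hsq (n : ℤ) : Nonempty (sq.map (HomologicalComplex.eval _ _ n)).LiftStruct := by
      have : Mono (i.f n) :=
        inferInstanceAs (Mono ((HomologicalComplex.eval A (ComplexShape.up ℤ) n).map i))
      have := (hp n).hasLiftingProperty (i.f n)
      exact (this.sq_hasLift (sq.map (HomologicalComplex.eval _ _ n))).exists_lift
    -- The chosen degreewise lifts need not commute with differentials. The defect is a 1-cocycle
    -- from `cokernel i` to `kernel p`; a primitive of it corrects the lifts.
    let hsq' (n : ℤ) := (hsq n).some
    let z := CochainComplex.Lifting.cocycle₁ sq hsq' (hπ := cokernel.condition i)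
      (cokernelIsCokernel i) (hι := kernel.condition p) (kernelIsKernel p)
    obtain ⟨α, hα⟩ := (mem_coboundaries_iff z 0 (zero_add 1)).1
      ((CohomologyClass.toHom_mk_eq_zero_iff z).1 (h _))
    exact CochainComplex.Lifting.hasLift sq hsq' (cokernelIsCokernel i) (kernelIsKernel p) α hα

theorem hasLiftingProperty_of_coacyclic {X Y K L : CochainComplex A ℤ} (i : X ⟶ Y) [Mono i]
    (hi : coacyclic A (cokernel i)) (p : K ⟶ L) (hp : degreewiseEpiWithInjectiveKernel p) :
    HasLiftingProperty i p :=
  hasLiftingProperty_of_hom_eq_zero i p hp fun f ↦ hi f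
    (injComplexes_shift ((degreewiseEpiWithInjectiveKernel_iff p).1 hp).2 1)

/-! ### Contractible cones and cocones. -/

theorem isZero_quotient_mappingCone_id (K : CochainComplex A ℤ) :
    IsZero ((Qh).obj (mappingCone (𝟙 K))) := by
  refine (Pretriangulated.Triangle.isZero₃_iff_isIso₁ _
    (HomotopyCategory.mappingCone_triangleh_distinguished (𝟙 K))).2 ?_
  exact inferInstanceAs (IsIso ((Qh).map (𝟙 K)))

theorem isZero_quotient_mappingCocone_id (K : CochainComplex A ℤ) :
    IsZero ((Qh).obj (mappingCocone (𝟙 K))) :=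
  IsZero.of_iso ((CategoryTheory.shiftFunctor _ (-1 : ℤ)).map_isZero (isZero_quotient_mappingCone_id K))
    (((Qh).commShiftIso (-1 : ℤ)).app _)

theorem degreewiseEpiWithInjectiveKernel_mappingCocone_fst {J : CochainComplex A ℤ}
    (hJ : injComplexes A J) :
    degreewiseEpiWithInjectiveKernel (mappingCocone.fst (𝟙 J)) := fun n ↦ by
  rw [epiWithInjectiveKernel_iff]
  exact ⟨J.X (n - 1), hJ _, (mappingCocone.inr (𝟙 J)).1.v (n - 1) n (by lia), by simp,
    ⟨{ r := (mappingCocone.snd (𝟙 J)).v n (n - 1) (by lia)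
       s := (mappingCocone.inl (𝟙 J)).v n n (add_zero n)
       f_r := by simp
       s_g := by simp
       id := by simpa [add_comm] using mappingCocone.id_X (𝟙 J) n (n - 1) (by lia) }⟩⟩

/-- With its converse `quotient_map_comp_mappingCocone_fst`, this turns null-homotopy into a strict
lifting problem. -/
theorem exists_lift_mappingCocone {X J : CochainComplex A ℤ} (f : X ⟶ J)
    (hf : (Qh).map f = 0) : ∃ g : X ⟶ mappingCocone (𝟙 J), g ≫ mappingCocone.fst (𝟙 J) = f := by
  obtain ⟨h⟩ := (HomotopyCategory.quotient_map_eq_zero_iff f).1 hf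
  obtain ⟨z, hz⟩ := Cochain.equivHomotopy _ _ h
  exact ⟨mappingCocone.lift _ f (-z) (by simp [hz]), by simp⟩

theorem quotient_map_comp_mappingCocone_fst {X J : CochainComplex A ℤ}
    (g : X ⟶ mappingCocone (𝟙 J)) : (Qh).map (g ≫ mappingCocone.fst (𝟙 J)) = 0 := by
  rw [Functor.map_comp, (isZero_quotient_mappingCocone_id J).eq_of_tgt ((Qh).map g) 0,
    zero_comp]

/-! ### Coderived equivalences and coacyclic complexes. -/

variable (A) in
/-- The morphisms of complexes which induce bijections on the homotopy classes of morphisms to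
complexes of injective objects. -/
def coderivedEquivalences : MorphismProperty (CochainComplex A ℤ) :=
  (injComplexesHot A).isLocal.inverseImage (HomotopyCategory.quotient _ (ComplexShape.up ℤ))

instance : (coderivedEquivalences A).HasTwoOutOfThreeProperty :=
  inferInstanceAs ((injComplexesHot A).isLocal.inverseImage _).HasTwoOutOfThreeProperty

theorem coderivedEquivalences_iff {X Y : CochainComplex A ℤ} (f : X ⟶ Y) :
    coderivedEquivalences A f ↔ ∀ ⦃J : CochainComplex A ℤ⦄, injComplexes A J →
      (∀ g : Y ⟶ J, (Qh).map (f ≫ g) = 0 → (Qh).map g = 0) ∧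
      (∀ g : X ⟶ J, ∃ h : Y ⟶ J, (Qh).map (f ≫ h) = (Qh).map g) := by
  constructor
  · intro hf J hJ
    refine ⟨fun g hg ↦ (hf ((Qh).obj J) hJ).1 ?_, fun g ↦ ?_⟩
    · simpa using hg
    · obtain ⟨h, hh⟩ := (hf ((Qh).obj J) hJ).2 ((Qh).map g)
      obtain ⟨h, rfl⟩ := (Qh).map_surjective h
      exact ⟨h, by simpa using hh⟩
  · intro hf J hJ
    obtain ⟨J, rfl⟩ := HomotopyCategory.quotient_obj_surjective J
    refine ⟨fun g₁ g₂ hg ↦ ?_, fun g ↦ ?_⟩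
    · obtain ⟨g₁, rfl⟩ := (Qh).map_surjective g₁
      obtain ⟨g₂, rfl⟩ := (Qh).map_surjective g₂
      rw [← sub_eq_zero, ← Functor.map_sub]
      refine (hf (J := J) hJ).1 _ ?_
      rw [Preadditive.comp_sub, Functor.map_sub, sub_eq_zero]
      simpa using hg
    · obtain ⟨g, rfl⟩ := (Qh).map_surjective g
      obtain ⟨h, hh⟩ := (hf (J := J) hJ).2 g
      exact ⟨(Qh).map h, ((Qh).map_comp f h).symm.trans hh⟩

/-- Lifting against `mappingCocone (𝟙 J) ⟶ J` gives injectivity on homotopy classes; lifting against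
`J ⟶ 0` gives surjectivity. -/
theorem coderivedEquivalences_of_llp {X Y : CochainComplex A ℤ} {f : X ⟶ Y}
    (hf : degreewiseEpiWithInjectiveKernel.llp f) : coderivedEquivalences A f := by
  rw [coderivedEquivalences_iff]
  intro J hJ
  constructor
  · intro g hg
    obtain ⟨t, ht⟩ := exists_lift_mappingCocone _ hg
    have := hf _ (degreewiseEpiWithInjectiveKernel_mappingCocone_fst hJ)
    have sq : CommSq t f (mappingCocone.fst (𝟙 J)) g := ⟨ht⟩
    rw [← sq.fac_right]
    exact quotient_map_comp_mappingCocone_fst _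
  · intro g
    have := hf _ (degreewiseEpiWithInjectiveKernel_zero hJ (isZero_zero _) (0 : J ⟶ 0))
    have sq : CommSq g f (0 : J ⟶ 0) 0 := ⟨by simp⟩
    exact ⟨sq.lift, by rw [sq.fac_left]⟩

theorem coderivedEquivalences_zero_iff (X : CochainComplex A ℤ) :
    coderivedEquivalences A (0 : (0 : CochainComplex A ℤ) ⟶ X) ↔ coacyclic A X := by
  rw [coderivedEquivalences_iff, coacyclic_iff]
  refine forall₂_congr fun J hJ ↦ ⟨fun h g ↦ h.1 g (by simp), fun h ↦ ⟨fun g _ ↦ h g, fun g ↦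
    ⟨0, by rw [(isZero_zero _).eq_of_src g 0, comp_zero]⟩⟩⟩

theorem coacyclic_of_llp {X : CochainComplex A ℤ}
    (hX : degreewiseEpiWithInjectiveKernel.llp (0 : (0 : CochainComplex A ℤ) ⟶ X)) :
    coacyclic A X :=
  (coderivedEquivalences_zero_iff X).1 (coderivedEquivalences_of_llp hX)

theorem injComplexes_mappingCocone_id {J : CochainComplex A ℤ} (hJ : injComplexes A J) :
    injComplexes A (mappingCocone (𝟙 J)) := by
  have := MorphismProperty.comp_mem _ _ _
    (degreewiseEpiWithInjectiveKernel_mappingCocone_fst hJ)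
    (degreewiseEpiWithInjectiveKernel_zero hJ (isZero_zero _) (0 : J ⟶ 0))
  exact (degreewiseEpiWithInjectiveKernel_iff_of_isZero _ (isZero_zero _)).1 this

/-- The obstruction to extending a map into this complex lies in Hom to a shift of a contractible
complex, hence vanishes. -/
theorem injective_mappingCocone_id {J : CochainComplex A ℤ} (hJ : injComplexes A J) :
    Injective (mappingCocone (𝟙 J)) := by
  rw [injective_iff_rlp_monomorphisms_zero]
  intro X Y i (_ : Mono i)
  refine hasLiftingProperty_of_hom_eq_zero i _ (degreewiseEpiWithInjectiveKernel_zero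
    (injComplexes_mappingCocone_id hJ) (isZero_zero _) _) fun f ↦ IsZero.eq_of_tgt ?_ _ _
  have e : kernel (0 : mappingCocone (𝟙 J) ⟶ 0) ≅ mappingCocone (𝟙 J) := kernelZeroIsoSource
  exact IsZero.of_iso ((CategoryTheory.shiftFunctor _ (1 : ℤ)).map_isZero (isZero_quotient_mappingCocone_id J))
    ((Qh).mapIso ((CategoryTheory.shiftFunctor _ (1 : ℤ)).mapIso e) ≪≫ ((Qh).commShiftIso (1 : ℤ)).app _)

theorem coacyclic_cokernel_of_coderivedEquivalences {X Y : CochainComplex A ℤ} (f : X ⟶ Y)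
    [Mono f] (hf : coderivedEquivalences A f) : coacyclic A (cokernel f) := by
  rw [coacyclic_iff]
  intro J hJ k
  rw [coderivedEquivalences_iff] at hf
  let q := mappingCocone.fst (𝟙 J)
  have hq := degreewiseEpiWithInjectiveKernel_mappingCocone_fst hJ
  have hK := ((degreewiseEpiWithInjectiveKernel_iff _).1 hq).2
  -- The goal is to lift `k` along `q`. The lift `t` on `Y` need not vanish on `X`, but its
  -- restriction `e` lands in `kernel q`.
  obtain ⟨t, ht⟩ := exists_lift_mappingCocone (cokernel.π f ≫ k) ((hf hJ).1 _ (by simp))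
  obtain ⟨e, he⟩ : ∃ e : X ⟶ kernel q, e ≫ kernel.ι q = f ≫ t :=
    ⟨kernel.lift q (f ≫ t) (by simp [q, ht]), by simp⟩
  -- `e` extends to `Y` up to homotopy. The homotopy factors through an injective complex, so it
  -- extends too, giving the strict extension `e''`; subtracting it from `t` yields a map that
  -- descends to the cokernel.
  obtain ⟨e', he'⟩ := (hf hK).2 e
  obtain ⟨s, hs⟩ := exists_lift_mappingCocone (e - f ≫ e')
    (by rw [Functor.map_sub, he', sub_self])
  have := injective_mappingCocone_id hK
  let e'' := e' + Injective.factorThru s f ≫ mappingCocone.fst (𝟙 (kernel q))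
  have he'' : f ≫ e'' = e := by simp [e'', hs]
  have hk : k = cokernel.desc f (t - e'' ≫ kernel.ι q)
      (by rw [Preadditive.comp_sub, reassoc_of% he'', he, sub_self]) ≫ q := by
    rw [← cancel_epi (cokernel.π f)]
    simp [q, ht]
  rw [hk]
  exact quotient_map_comp_mappingCocone_fst _

theorem mono_and_coderivedEquivalences_iff {X Y : CochainComplex A ℤ} (f : X ⟶ Y) [Mono f] :
    coderivedEquivalences A f ↔ coacyclic A (cokernel f) :=
  ⟨coacyclic_cokernel_of_coderivedEquivalences f, fun h ↦
    coderivedEquivalences_of_llp fun _ _ p hp ↦ hasLiftingProperty_of_coacyclic f h p hp⟩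

/-- The kernel inclusion has coacyclic cokernel, so it is a coderived equivalence; two-out-of-three
with `0 ⟶ X` concludes. -/
theorem coacyclic_kernel : ClosedUnderKernelsOfEpis (coacyclic A) := by
  intro X Y f _ hX hY
  have hS : (ShortComplex.mk (kernel.ι f) f (kernel.condition f)).ShortExact :=
    { exact := ShortComplex.exact_of_f_is_kernel _ (kernelIsKernel f) }
  have e : cokernel (kernel.ι f) ≅ Y :=
    (cokernelIsCokernel _).coconePointUniqueUpToIso hS.gIsCokernel
  have h₁ : coderivedEquivalences A (kernel.ι f) := by
    rw [mono_and_coderivedEquivalences_iff]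
    exact (injComplexesHot A).leftOrthogonal.prop_of_iso ((Qh).mapIso e.symm) hY
  rw [← coderivedEquivalences_zero_iff] at hX ⊢
  exact MorphismProperty.of_postcomp _ _ _ h₁ (by simpa using hX)

theorem coacyclic_cokernel : ClosedUnderCokernelsOfMonos (coacyclic A) := by
  intro X Y f _ hX hY
  rw [← mono_and_coderivedEquivalences_iff]
  rw [← coderivedEquivalences_zero_iff] at hX hY
  exact MorphismProperty.of_precomp _ _ _ hX (by simpa using hY)

/-- `p` is a homotopy equivalence: it has a section `s`, and `𝟙 X - p ≫ s` extends over the cone of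
`𝟙 X`, so it is null-homotopic. -/
theorem coderivedEquivalences_of_rlp {X Y : CochainComplex A ℤ} (p : X ⟶ Y)
    (hp : (monomorphisms (CochainComplex A ℤ)).rlp p) : coderivedEquivalences A p := by
  have := hp (0 : (0 : CochainComplex A ℤ) ⟶ Y) (inferInstanceAs (Mono _))
  have sq : CommSq (0 : (0 : CochainComplex A ℤ) ⟶ X) (0 : (0 : CochainComplex A ℤ) ⟶ Y) p
    (𝟙 Y) := ⟨by simp⟩
  have hs : sq.lift ≫ p = 𝟙 Y := sq.fac_right
  have : Mono (mappingCone.inr (𝟙 X)) := HomologicalComplex.mono_of_mono_f _ fun n ↦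
    mono_of_mono_fac (mappingCone.inr_f_snd_v (𝟙 X) n)
  have := hp (mappingCone.inr (𝟙 X)) this
  have sq' : CommSq (𝟙 X - p ≫ sq.lift) (mappingCone.inr (𝟙 X)) p 0 := ⟨by simp [hs]⟩
  have h : (Qh).map p ≫ (Qh).map sq.lift = 𝟙 _ := by
    rw [← Functor.map_comp, ← (Qh).map_id, eq_comm, ← sub_eq_zero, ← Functor.map_sub,
      ← sq'.fac_left, Functor.map_comp,
      (isZero_quotient_mappingCone_id X).eq_of_src ((Qh).map sq'.lift) 0, comp_zero]
  have : IsIso ((Qh).map p) := ⟨(Qh).map sq.lift, h, by rw [← Functor.map_comp, hs,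
    (Qh).map_id]⟩
  exact (injComplexesHot A).isLocal_of_isIso _

/-! ### Maps out of the complexes `G⁺(S)[i]`. -/

/-- Morphisms from `G⁺(S)[i]` to a complex `C` are identified with morphisms from `S` to `C⁻ⁱ`. -/
theorem exists_gPlus_equiv (S : A) (i : ℤ) :
    ∃ e : ∀ C : CochainComplex A ℤ, ((GPlus S)⟦i⟧ ⟶ C) ≃ (S ⟶ C.X (0 + -i)),
      ∀ ⦃C D : CochainComplex A ℤ⦄ (f : (GPlus S)⟦i⟧ ⟶ C) (g : C ⟶ D),
        e D (f ≫ g) = e C f ≫ g.f (0 + -i) := by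
  let adj := (shiftEquiv (CochainComplex A ℤ) i).toAdjunction
  let c : (HomologicalComplex.eval A (ComplexShape.up ℤ) 0 ⋙
      coyoneda.obj (Opposite.op S)).CorepresentableBy (GPlus S) :=
    HomologicalComplex.evalCompCoyonedaCorepresentableByDoubleId _ (by lia) S
  -- Degree `0` of `C⟦-i⟧` is by definition `C.X (0 + -i)`, whence this form of the degree.
  refine ⟨fun C ↦ (adj.homEquiv (GPlus S) C).trans c.homEquiv, fun C D f g ↦ ?_⟩
  exact (congrArg c.homEquiv (adj.homEquiv_naturality_right f g)).trans (c.homEquiv_comp _ _)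

theorem exists_lift_gPlus_iff (S : A) (i : ℤ) {C D : CochainComplex A ℤ} (p : C ⟶ D) :
    (∀ f : (GPlus S)⟦i⟧ ⟶ D, ∃ g, g ≫ p = f) ↔
      ∀ f : S ⟶ D.X (0 + -i), ∃ g, g ≫ p.f (0 + -i) = f := by
  obtain ⟨e, he⟩ := exists_gPlus_equiv S i
  constructor
  · intro h f
    obtain ⟨g, hg⟩ := h ((e D).symm f)
    exact ⟨e C g, by rw [← he, hg, Equiv.apply_symm_apply]⟩
  · intro h f
    obtain ⟨g, hg⟩ := h (e D f)
    exact ⟨(e C).symm g, (e D).injective (by rw [he, Equiv.apply_symm_apply, hg])⟩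

/-- An epimorphism with injective kernel splits, so maps from `G⁺(S)[i]` lift along degreewise such
epimorphisms. -/
theorem coacyclic_gPlus (S : A) (i : ℤ) : coacyclic A ((GPlus S)⟦i⟧) := by
  refine coacyclic_of_llp fun X Y p hp ↦ ⟨fun {a b} sq ↦ ?_⟩
  obtain ⟨s, hs⟩ := (exists_lift_gPlus_iff S i p).2 (fun f ↦ by
    obtain ⟨_, _, _, _, ⟨σ⟩⟩ := (epiWithInjectiveKernel_iff _).1 (hp _)
    exact ⟨f ≫ σ.s, by rw [Category.assoc, σ.s_g]; exact Category.comp_id f⟩) b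
  exact ⟨⟨⟨s, (isZero_zero _).eq_of_src _ _, hs⟩⟩⟩

theorem degreewiseEpiWithInjectiveKernel_of_shortExact {S : ShortComplex (CochainComplex A ℤ)}
    (hS : S.ShortExact) (h : injComplexes A S.X₁) : degreewiseEpiWithInjectiveKernel S.g := by
  rw [degreewiseEpiWithInjectiveKernel_iff]
  exact ⟨hS.epi_g, injComplexes_of_iso
    (IsLimit.conePointUniqueUpToIso hS.fIsKernel (limit.isLimit _)) h⟩

end TermwiseInjective

/-! ### The two weak factorization systems and the model structure. -/

section Grothendieck

variable (A : Type u) [Category.{v} A] [Abelian A] [IsGrothendieckAbelian.{w} A]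

/-- The generating trivial cofibrations: the monomorphisms `doubleId n S ⟶ doubleId n G` for the
subobjects `S` of a generator `G`. -/
def generatingTrivialCofibrations : MorphismProperty (CochainComplex A ℤ) :=
  ofHoms fun x : ℤ × Subobject (separator A) ↦ doubleIdMap x.1 x.2.arrow

instance : IsSmall.{w} (generatingTrivialCofibrations A) := by
  dsimp only [generatingTrivialCofibrations]
  infer_instance

instance : HasSmallObjectArgument.{w} (generatingTrivialCofibrations A) :=
  hasSmallObjectArgument_ofHoms_of_mono _

theorem generatingTrivialCofibrations_rlp :
    (generatingTrivialCofibrations A).rlp = degreewiseEpiWithInjectiveKernel := by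
  ext X Y p
  simp only [degreewiseEpiWithInjectiveKernel]
  rw [← rlp_monomorphisms_eq,
    ← IsGrothendieckAbelian.generatingMonomorphisms_rlp.{w} (isSeparator_separator A)]
  constructor
  · rintro h n _ _ _ ⟨S⟩
    exact (hasLiftingProperty_doubleIdMap_iff n S.arrow p).1 (h _ ⟨(n, S)⟩)
  · rintro h _ _ _ ⟨n, S⟩
    exact (hasLiftingProperty_doubleIdMap_iff n S.arrow p).2 (h n _ ⟨S⟩)

instance hasFactorization_llp_degreewiseEpiWithInjectiveKernel :
    HasFactorization (degreewiseEpiWithInjectiveKernel (C := A)).llp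
      degreewiseEpiWithInjectiveKernel := by
  rw [← generatingTrivialCofibrations_rlp.{w} A]
  infer_instance

theorem rlp_monomorphisms_le :
    (monomorphisms (CochainComplex A ℤ)).rlp ≤ degreewiseEpiWithInjectiveKernel := by
  rw [← generatingTrivialCofibrations_rlp.{w} A]
  refine antitone_rlp ?_
  rintro _ _ _ ⟨n, S⟩
  exact inferInstanceAs (Mono (doubleIdMap n S.arrow))

theorem llp_degreewiseEpiWithInjectiveKernel_le :
    (degreewiseEpiWithInjectiveKernel (C := A)).llp ≤ monomorphisms _ := by
  rw [← IsGrothendieckAbelian.llp_rlp_monomorphisms.{w}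
    (isSeparator_separator (CochainComplex A ℤ))]
  exact antitone_llp (rlp_monomorphisms_le A)

theorem llp_degreewiseEpiWithInjectiveKernel_eq :
    (degreewiseEpiWithInjectiveKernel (C := A)).llp =
      monomorphisms _ ⊓ coderivedEquivalences A := by
  refine le_antisymm (fun X Y f hf ↦ ⟨llp_degreewiseEpiWithInjectiveKernel_le A _ hf,
    coderivedEquivalences_of_llp hf⟩) ?_
  rintro X Y f ⟨hf : Mono f, hf'⟩ _ _ p hp
  exact hasLiftingProperty_of_coacyclic f (coacyclic_cokernel_of_coderivedEquivalences f hf') p hp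

/-- For the nontrivial inclusion, the retract argument: factor `f` as a monomorphism followed by a
map in the right class. By two-out-of-three the monomorphism is a trivial cofibration, so it lifts
against `f`, and `f` is a retract of the second factor. -/
theorem rlp_monomorphisms_eq_inf :
    (monomorphisms (CochainComplex A ℤ)).rlp =
      degreewiseEpiWithInjectiveKernel ⊓ coderivedEquivalences A := by
  refine le_antisymm (fun X Y f hf ↦ ⟨rlp_monomorphisms_le A _ hf,
    coderivedEquivalences_of_rlp f hf⟩) ?_
  rintro X Y f ⟨hf, hf'⟩
  let h := factorizationData (monomorphisms (CochainComplex A ℤ)) (monomorphisms _).rlp f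
  have hi : coderivedEquivalences A h.i :=
    of_postcomp _ _ _ (coderivedEquivalences_of_rlp h.p h.hp) (by rwa [h.fac])
  have hi' : (degreewiseEpiWithInjectiveKernel (C := A)).llp h.i := by
    rw [llp_degreewiseEpiWithInjectiveKernel_eq]
    exact ⟨h.hi, hi⟩
  have := hi' f hf
  exact MorphismProperty.of_retract (RetractArrow.ofRightLiftingProperty h.fac) h.hp

/-- The coderived model structure. -/
abbrev coderivedModelCategory : ModelCategory (CochainComplex A ℤ) :=
  letI : CategoryWithFibrations (CochainComplex A ℤ) := ⟨degreewiseEpiWithInjectiveKernel⟩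
  letI : CategoryWithCofibrations (CochainComplex A ℤ) := ⟨monomorphisms _⟩
  letI : CategoryWithWeakEquivalences (CochainComplex A ℤ) := ⟨coderivedEquivalences A⟩
  have : (weakEquivalences (CochainComplex A ℤ)).HasTwoOutOfThreeProperty :=
    inferInstanceAs (coderivedEquivalences A).HasTwoOutOfThreeProperty
  have h₁ : trivialFibrations (CochainComplex A ℤ) = (monomorphisms _).rlp :=
    (rlp_monomorphisms_eq_inf A).symm
  have h₂ : trivialCofibrations (CochainComplex A ℤ) =
      (degreewiseEpiWithInjectiveKernel (C := A)).llp :=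
    (llp_degreewiseEpiWithInjectiveKernel_eq A).symm
  have : IsWeakFactorizationSystem (cofibrations (CochainComplex A ℤ))
      (trivialFibrations (CochainComplex A ℤ)) := by
    have : HasFactorization (cofibrations (CochainComplex A ℤ))
        (trivialFibrations (CochainComplex A ℤ)) := by
      rw [h₁]
      exact inferInstanceAs (HasFactorization (monomorphisms _) (monomorphisms _).rlp)
    have : (cofibrations (CochainComplex A ℤ)).IsStableUnderRetracts :=
      inferInstanceAs (monomorphisms (CochainComplex A ℤ)).IsStableUnderRetracts
    have : (trivialFibrations (CochainComplex A ℤ)).IsStableUnderRetracts := by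
      rw [h₁]
      infer_instance
    exact IsWeakFactorizationSystem.mk' _ _ (fun i p hi hp ↦ by
      rw [h₁] at hp
      exact hp i hi)
  have : IsWeakFactorizationSystem (trivialCofibrations (CochainComplex A ℤ))
      (fibrations (CochainComplex A ℤ)) := by
    have : HasFactorization (trivialCofibrations (CochainComplex A ℤ))
        (fibrations (CochainComplex A ℤ)) := by
      rw [h₂]
      exact hasFactorization_llp_degreewiseEpiWithInjectiveKernel A
    have : (fibrations (CochainComplex A ℤ)).IsStableUnderRetracts :=
      inferInstanceAs (degreewiseEpiWithInjectiveKernel (C := A)).IsStableUnderRetracts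
    have : (trivialCofibrations (CochainComplex A ℤ)).IsStableUnderRetracts := by
      rw [h₂]
      infer_instance
    exact IsWeakFactorizationSystem.mk' _ _ (fun i p hi hp ↦ by
      rw [h₂] at hi
      exact hi p hp)
  ModelCategory.mk' _

theorem isCofGenHereditaryAbelianModelTriple :
    IsCofGenHereditaryAbelianModelTriple.{w} (⊤ : ObjectProperty (CochainComplex A ℤ))
      (coacyclic A) (injComplexes A) := by
  let _ : ModelCategory (CochainComplex A ℤ) := coderivedModelCategory A
  have hc {X Y : CochainComplex A ℤ} (f : X ⟶ Y) : Cofibration f ↔ Mono f :=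
    cofibration_iff f
  have hf {X Y : CochainComplex A ℤ} (f : X ⟶ Y) :
      Fibration f ↔ degreewiseEpiWithInjectiveKernel f := fibration_iff f
  have h₁ : cofibrant (E := CochainComplex A ℤ) = ⊤ := by
    ext X
    exact iff_of_true ((hc _).2 inferInstance) trivial
  have h₂ : weaklyTrivial (E := CochainComplex A ℤ) = coacyclic A := by
    ext X
    exact (weakEquivalence_iff _).trans (coderivedEquivalences_zero_iff X)
  have h₃ : fibrant (E := CochainComplex A ℤ) = injComplexes A := by
    ext X
    exact (hf _).trans (degreewiseEpiWithInjectiveKernel_iff_of_isZero _ (isZero_zero _))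
  refine ⟨inferInstance, ?_, ?_, h₁, h₂, h₃⟩
  · refine { cofibration_iff := fun f ↦ ?_, fibration_iff := fun f ↦ ?_,
             kernels_cofibrant := ?_, kernels_trivially_cofibrant := ?_,
             cokernels_fibrant := ?_, cokernels_trivially_fibrant := ?_ }
    · rw [hc, h₁]
      exact ⟨fun h ↦ ⟨h, trivial⟩, fun h ↦ h.1⟩
    · rw [hf, h₃, degreewiseEpiWithInjectiveKernel_iff]
    · rw [h₁]
      intro _ _ _ _ _ _
      trivial
    · rw [h₁, h₂, top_inf_eq]
      exact coacyclic_kernel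
    · rw [h₃]
      exact injComplexes_cokernel
    · rw [h₂, h₃]
      exact fun X Y f _ hX hY ↦
        ⟨injComplexes_cokernel f ‹_› hX.1 hY.1, coacyclic_cokernel f ‹_› hX.2 hY.2⟩
  · constructor
    · refine ⟨IsGrothendieckAbelian.generatingMonomorphisms (separator (CochainComplex A ℤ)),
        inferInstance, ?_⟩
      rw [IsGrothendieckAbelian.generatingMonomorphisms_rlp.{w} (isSeparator_separator _)]
      exact (rlp_monomorphisms_eq_inf A).symm
    · exact ⟨generatingTrivialCofibrations A, inferInstance,
        (generatingTrivialCofibrations_rlp A).symm⟩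

/-! ### The cotorsion pair and its generation. -/

section Cotorsion

variable {A}

theorem injComplexes_of_injective (I : CochainComplex A ℤ) [hI : Injective I] :
    injComplexes A I := by
  rw [injective_iff_rlp_monomorphisms_zero] at hI
  exact (degreewiseEpiWithInjectiveKernel_iff_of_isZero _ (isZero_zero _)).1
    (rlp_monomorphisms_le A _ hI)

/-- A short exact sequence embedding a complex into an injective object of the category of
complexes. -/
abbrev injectiveEmbedding (J : CochainComplex A ℤ) : ShortComplex (CochainComplex A ℤ) :=
  ShortComplex.mk (Injective.ι J) (cokernel.π (Injective.ι J)) (by simp)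

theorem injectiveEmbedding_shortExact (J : CochainComplex A ℤ) :
    (injectiveEmbedding J).ShortExact where
  exact := ShortComplex.exact_of_g_is_cokernel _ (cokernelIsCokernel _)

theorem injComplexes_injectiveEmbedding {J : CochainComplex A ℤ} (hJ : injComplexes A J) :
    injComplexes A (injectiveEmbedding J).X₃ :=
  injComplexes_cokernel _ inferInstance hJ (injComplexes_of_injective _)

theorem subsingleton_ext_one {X J : CochainComplex A ℤ} (hX : coacyclic A X)
    (hJ : injComplexes A J) : Subsingleton (Ext.{w} X J 1) := by
  refine subsingleton_ext_one_of_exists_lift (injectiveEmbedding_shortExact J) X fun f ↦ ?_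
  have : (degreewiseEpiWithInjectiveKernel (C := A)).llp (0 : (0 : CochainComplex A ℤ) ⟶ X) := by
    rw [llp_degreewiseEpiWithInjectiveKernel_eq]
    exact ⟨inferInstanceAs (Mono _), (coderivedEquivalences_zero_iff X).2 hX⟩
  have := this _ (degreewiseEpiWithInjectiveKernel_of_shortExact
    (injectiveEmbedding_shortExact J) hJ)
  have sq : CommSq (0 : (0 : CochainComplex A ℤ) ⟶ _) (0 : (0 : CochainComplex A ℤ) ⟶ X) (injectiveEmbedding J).g f := ⟨by simp⟩
  exact ⟨sq.lift, sq.fac_right⟩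

/-- Dimension shifting: the cokernel of `J` in an injective complex again has injective terms. -/
theorem subsingleton_ext {X J : CochainComplex A ℤ} (hX : coacyclic A X)
    (hJ : injComplexes A J) (n : ℕ) : Subsingleton (Ext.{w} X J (n + 1)) := by
  induction n generalizing J with
  | zero => exact subsingleton_ext_one hX hJ
  | succ n hn =>
    have := hn (injComplexes_injectiveEmbedding hJ)
    exact subsingleton_ext_succ (injectiveEmbedding_shortExact J) X (n + 1)

-- For the inclusion from right to left, Ext¹ vanishing is applied to the kernel of `mappingCocone
-- (𝟙 J) ⟶ J`, which has injective terms: every map `X ⟶ J` then lifts, so it is null-homotopic.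
variable (A) in
theorem coacyclic_eq_leftPerpOne : coacyclic A = leftPerpOne.{w} (injComplexes A) := by
  ext X
  refine ⟨fun hX J hJ ↦ subsingleton_ext_one hX hJ, fun hX ↦ ?_⟩
  rw [coacyclic_iff]
  intro J hJ f
  have hq := degreewiseEpiWithInjectiveKernel_mappingCocone_fst hJ
  have hS : (ShortComplex.mk (kernel.ι (mappingCocone.fst (𝟙 J))) _
      (kernel.condition _)).ShortExact :=
    { exact := ShortComplex.exact_of_f_is_kernel _ (kernelIsKernel _)
      epi_g := hq.epi }
  have := hX ((degreewiseEpiWithInjectiveKernel_iff _).1 hq).2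
  obtain ⟨g, rfl⟩ := exists_lift_of_subsingleton_ext hS X f
  exact quotient_map_comp_mappingCocone_fst g

/-- Embed `C` in an injective complex `I` with quotient `Q`. The Ext¹ condition lets maps from
objects of `S₀` lift along each `Iⁿ ⟶ Qⁿ`; filtrations by `S₀` upgrade this to a splitting, so `Cⁿ`
is a retract of the injective `Iⁿ`. -/
theorem rightPerpOne_shiftedGPlus {S₀ : ObjectProperty A} (hS₀ : Fil.{w} S₀ = ⊤) :
    rightPerpOne.{w} (shiftedGPlus S₀) = injComplexes A := by
  ext C
  constructor
  · intro hC n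
    obtain ⟨i, rfl⟩ : ∃ i, n = 0 + -i := ⟨-n, by lia⟩
    have hE := injectiveEmbedding_shortExact C
    have := injComplexes_of_injective (injectiveEmbedding C).X₂ (0 + -i)
    obtain ⟨⟨s⟩⟩ : IsSplitEpi ((injectiveEmbedding C).g.f (0 + -i)) := by
      refine isSplitEpi_of_fil_eq_top hS₀ _ fun S hS ↦ ?_
      have := hC ⟨S, i, hS, rfl⟩
      exact (exists_lift_gPlus_iff S i (injectiveEmbedding C).g).1
        (exists_lift_of_subsingleton_ext hE _)
    have hE' := hE.map_of_exact (HomologicalComplex.eval A (ComplexShape.up ℤ) (0 + -i))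
    have σ := ShortComplex.Splitting.ofExactOfSection _ hE'.exact
      s.section_ s.id hE'.mono_f
    exact Retract.injective (X := C.X (0 + -i)) (Y := (injectiveEmbedding C).X₂.X (0 + -i))
      ⟨(injectiveEmbedding C).f.f (0 + -i), σ.r, σ.f_r⟩
  · rintro hC _ ⟨S, i, hS, rfl⟩
    exact subsingleton_ext_one (coacyclic_gPlus S i) hC

variable (A)

theorem isCotorsionPair_coacyclic :
    IsCotorsionPair.{w} (coacyclic A) (injComplexes A) where
  right_eq := by
    obtain ⟨S₀, _, hS₀⟩ := exists_small_fil_eq_top.{w} (E := A)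
    -- For the reverse inclusion, testing against the coacyclic complexes `G⁺(S)[i]` alone already
    -- forces injective terms.
    refine le_antisymm (fun J hJ X hX ↦ subsingleton_ext_one hX hJ) ?_
    rw [← rightPerpOne_shiftedGPlus.{w} hS₀]
    rintro J hJ _ ⟨S, i, hS, rfl⟩
    exact hJ (coacyclic_gPlus S i)
  left_eq := coacyclic_eq_leftPerpOne A

theorem exists_preenvelope (X : CochainComplex A ℤ) :
    ∃ (J : CochainComplex A ℤ) (i : X ⟶ J), injComplexes A J ∧
      (degreewiseEpiWithInjectiveKernel (C := A)).llp i := by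
  let h := factorizationData (degreewiseEpiWithInjectiveKernel (C := A)).llp
    degreewiseEpiWithInjectiveKernel (0 : X ⟶ 0)
  exact ⟨h.Z, h.i, (degreewiseEpiWithInjectiveKernel_iff_of_isZero _ (isZero_zero _)).1 h.hp, h.hi⟩

theorem hasApproximationSequences :
    HasApproximationSequences (coacyclic A) (injComplexes A) where
  exists_precover X := by
    let h := factorizationData (degreewiseEpiWithInjectiveKernel (C := A)).llp
      degreewiseEpiWithInjectiveKernel (0 : 0 ⟶ X)
    have hp := (degreewiseEpiWithInjectiveKernel_iff _).1 h.hp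
    have := hp.1
    refine ⟨kernel h.p, h.Z, kernel.ι _, h.p, kernel.condition _,
      { exact := ShortComplex.exact_of_f_is_kernel _ (kernelIsKernel _) }, hp.2,
      coacyclic_of_llp ?_⟩
    rw [← (isZero_zero _).eq_of_src h.i 0]
    exact h.hi
  exists_preenvelope X := by
    obtain ⟨J, i, hJ, hi⟩ := exists_preenvelope A X
    have : Mono i := llp_degreewiseEpiWithInjectiveKernel_le A _ hi
    exact ⟨J, cokernel i, i, cokernel.π i, cokernel.condition _,
      { exact := ShortComplex.exact_of_g_is_cokernel _ (cokernelIsCokernel _) }, hJ,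
      coacyclic_cokernel_of_coderivedEquivalences i (coderivedEquivalences_of_llp hi)⟩

theorem isHereditaryCompleteCotorsionPair :
    IsHereditaryCompleteCotorsionPair.{w} (coacyclic A) (injComplexes A) where
  isCotorsionPair := isCotorsionPair_coacyclic A
  complete := hasApproximationSequences A
  kernels := coacyclic_kernel
  cokernels := injComplexes_cokernel
  ext_eq_zero X Y hX hY n hn := by
    obtain ⟨n, rfl⟩ := Nat.exists_eq_add_of_le' hn
    exact subsingleton_ext hX hY n

end Cotorsion

/-! ### K(A_inj) and the coderived category. -/

section Equivalence

/-- A map from the cone `Z` to `J` dies on `Y` by injectivity, so it factors through `X⟦1⟧`.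
Surjectivity for `J⟦-1⟧`, available by shift stability, extends that factor along `f⟦1⟧`, and `h ≫
f⟦1⟧ = 0`. -/
theorem trW_leftOrthogonal_of_isLocal {K : Type*} [Category* K] [HasZeroObject K]
    [HasShift K ℤ] [Preadditive K] [∀ n : ℤ, (CategoryTheory.shiftFunctor K n).Additive]
    [Pretriangulated K] (P : ObjectProperty K) [P.IsStableUnderShift ℤ] {X Y : K} {f : X ⟶ Y}
    (hf : P.isLocal f) : P.leftOrthogonal.trW f := by
  obtain ⟨Z, g, h, hT⟩ := Pretriangulated.distinguished_cocone_triangle f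
  have h₁ : f ≫ g = 0 := Pretriangulated.comp_distTriang_mor_zero₁₂ _ hT
  have h₂ : h ≫ f⟦(1 : ℤ)⟧' = 0 := Pretriangulated.comp_distTriang_mor_zero₃₁ _ hT
  refine (ObjectProperty.trW_iff _ _).2 ⟨Z, g, h, hT, fun J k hJ ↦ ?_⟩
  obtain ⟨l, hl⟩ := Pretriangulated.Triangle.yoneda_exact₃ _ hT k ((hf J hJ).1 (by
    change f ≫ g ≫ k = f ≫ 0
    rw [reassoc_of% h₁, zero_comp, comp_zero]))
  replace hl : k = h ≫ l := hl
  obtain ⟨m, rfl⟩ : ∃ m : Y⟦(1 : ℤ)⟧ ⟶ J, f⟦1⟧' ≫ m = l := by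
    obtain ⟨l', rfl⟩ := ((shiftEquiv K (1 : ℤ)).toAdjunction.homEquiv _ _).symm.surjective l
    obtain ⟨m', rfl⟩ := (hf _ (P.le_shift (-1) _ hJ)).2 l'
    exact ⟨((shiftEquiv K (1 : ℤ)).toAdjunction.homEquiv _ _).symm m',
      (((shiftEquiv K (1 : ℤ)).toAdjunction.homEquiv_naturality_left_symm _ _)).symm⟩
  rw [hl, reassoc_of% h₂, zero_comp]

theorem isEquivalence_injToCoderived : (injToCoderived A).IsEquivalence := by
  let F := (InjectiveObject.ι A).mapHomotopyCategory (ComplexShape.up ℤ)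
  have hF (X) : injComplexesHot A (F.obj X) := by
    obtain ⟨X, rfl⟩ := HomotopyCategory.quotient_obj_surjective X
    exact fun n ↦ (X.X n).2
  have hb (X Y) : Function.Bijective ((injToCoderived A).map : (X ⟶ Y) → _) := by
    -- The Verdier quotient functor is bijective on morphisms into right orthogonal objects.
    have h : (coacyclicHot A).rightOrthogonal (F.obj Y) := fun Z f hZ ↦ hZ f (hF Y)
    exact (ObjectProperty.rightOrthogonal.map_bijective_of_isTriangulated h
      (coacyclicHot A).trW.Q _).comp ⟨F.map_injective, F.map_surjective⟩
  have : (injToCoderived A).Full := ⟨fun {X Y} ↦ (hb X Y).2⟩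
  have : (injToCoderived A).Faithful := ⟨fun {X Y} f g h ↦ (hb X Y).1 h⟩
  have : (injToCoderived A).EssSurj := by
    refine ⟨fun Z ↦ ?_⟩
    obtain ⟨X, ⟨e⟩⟩ : ∃ X, Nonempty ((coacyclicHot A).trW.Q.obj X ≅ Z) :=
      ⟨_, ⟨(coacyclicHot A).trW.Q.objObjPreimageIso Z⟩⟩
    obtain ⟨X, rfl⟩ := HomotopyCategory.quotient_obj_surjective X
    -- A fibrant replacement becomes an isomorphism in the quotient.
    obtain ⟨J, i, hJ, hi⟩ := exists_preenvelope.{w} A X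
    have : IsIso ((coacyclicHot A).trW.Q.map
        ((HomotopyCategory.quotient A (ComplexShape.up ℤ)).map i)) :=
      Localization.inverts (coacyclicHot A).trW.Q (coacyclicHot A).trW _
        (trW_leftOrthogonal_of_isLocal (injComplexesHot A) (coderivedEquivalences_of_llp hi))
    let J' : CochainComplex (InjectiveObject A) ℤ :=
      HomologicalComplex.liftObjectProperty _ J hJ
    exact ⟨(HomotopyCategory.quotient _ _).obj J', ⟨(asIso ((coacyclicHot A).trW.Q.map
        ((HomotopyCategory.quotient A (ComplexShape.up ℤ)).map i))).symm ≪≫ e⟩⟩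
  exact { }

end Equivalence

end Grothendieck

end CoderivedModel

end

theorem mainTheorem9 (A : Type u) [Category.{v} A] [Abelian A]
    [IsGrothendieckAbelian.{w} A] :
    -- the pair is a hereditary complete cotorsion pair
    CoderivedModel.IsHereditaryCompleteCotorsionPair.{w}
      (CoderivedModel.coacyclic A) (CoderivedModel.injComplexes A) ∧
    -- it is generated by the complexes `G⁺(S)[i]`, for any set `S₀` of objects filtering `A`
    (∀ S₀ : ObjectProperty A, ObjectProperty.Small.{w} S₀ → CoderivedModel.Fil.{w} S₀ = ⊤ →
      CoderivedModel.IsGeneratedBy.{w} (CoderivedModel.coacyclic A)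
        (CoderivedModel.injComplexes A) (CoderivedModel.shiftedGPlus S₀)) ∧
    -- and such a set exists
    (∃ S₀ : ObjectProperty A, ObjectProperty.Small.{w} S₀ ∧ CoderivedModel.Fil.{w} S₀ = ⊤) ∧
    -- the coderived model structure
    CoderivedModel.IsCofGenHereditaryAbelianModelTriple.{w} (⊤ : ObjectProperty (CochainComplex A ℤ))
      (CoderivedModel.coacyclic A) (CoderivedModel.injComplexes A) ∧
    -- the triangulated equivalence between `K(A_inj)` and the coderived category
    (CoderivedModel.injToCoderived A).IsTriangulated ∧
    (CoderivedModel.injToCoderived A).IsEquivalence := by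
  refine ⟨CoderivedModel.isHereditaryCompleteCotorsionPair A, fun S₀ _ hS₀ ↦
    ⟨(CoderivedModel.rightPerpOne_shiftedGPlus hS₀).symm,
      CoderivedModel.coacyclic_eq_leftPerpOne A⟩, CoderivedModel.exists_small_fil_eq_top,
    CoderivedModel.isCofGenHereditaryAbelianModelTriple A, ?_,
    CoderivedModel.isEquivalence_injToCoderived.{w} A⟩
  infer_instance
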